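/- Graphs are finite and undirected and may have loops and parallel edges; a loop counts twice in the valence of its vertex. A graph is called \emph{upper-embeddable} if it is connected and has a $2$-cell embedding with one or two faces in some orientable surface (equivalently, if its maximum orientable genus is $\lfloor (|E|-|V|+1)/2\rfloor$); here $2$-cell embeddings are specified by rotation systems, i.e. cyclic orderings of the edge-ends at every vertex, and faces are obtained by face tracing. Let $H_3$ be the graph obtained from $K_{2,3}$ by attaching a pendant vertex, called a free node, to each of its three $2$-valent vertices. Let $G$ be a graph and let $T_n=\{t_0,\dots,t_{n-1}\}$ ($n\ge 0$) be a family of unordered triples of distinct $2$-valent vertices of $G$ (different triples may share vertices). The \emph{scaffolded graph} $H(G,T_n)$ is formed from $G$ and $n$ copies of $H_3$ by identifying the three free nodes of the $i$-th copy one-to-one with the three vertices of $t_i$, for each $i$. \textbf{Proposition.} If $G$ is upper-embeddable, then $H(G,T_n)$ is upper-embeddable for every choice of $T_n$. -/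

import Mathlib

/-! Multigraphs (loops and parallel edges allowed) are Mathlib's `Graph α β`. -/

namespace Scaffold

variable {α β : Type*}

/-- Valence of a vertex: the number of edge-ends at `x`, a loop counting twice. -/
noncomputable def valence (G : Graph α β) (x : α) : ℕ :=
  {e | G.IsNonloopAt e x}.ncard + 2 * {e | G.IsLoopAt e x}.ncard

/-- `G` is nonempty and any two vertices are joined by a path. -/
def IsConnected (G : Graph α β) : Prop :=
  G.vertexSet.Nonempty ∧
    ∀ x ∈ G.vertexSet, ∀ y ∈ G.vertexSet, Relation.ReflTransGen G.Adj x y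

/-- The edge-ends of `G`: each edge `e` has the two ends `(e, false)` and `(e, true)`. -/
abbrev EdgeEnd (G : Graph α β) : Type _ := G.edgeSet × Bool

/-- The opposite end of the same edge. -/
def EdgeEnd.flip (G : Graph α β) : Equiv.Perm (EdgeEnd G) :=
  (Equiv.refl _).prodCongr Equiv.boolNot

/-- A rotation system of a finite multigraph: a cyclic ordering of the edge-ends at every vertex.
It encodes a 2-cell embedding of a (finite connected) graph in an orientable surface,
up to equivalence. -/
structure RotationSystem (G : Graph α β) where
  /-- The vertex at which an edge-end lies (so the two ends of every edge get labelled). -/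
  vert : EdgeEnd G → α
  isLink : ∀ e : G.edgeSet, G.IsLink e.1 (vert (e, false)) (vert (e, true))
  /-- The successor of an edge-end in the cyclic ordering at its vertex. -/
  rot : Equiv.Perm (EdgeEnd G)
  /-- The cycles of `rot` are exactly the sets of all edge-ends at a common vertex. -/
  sameCycle_iff : ∀ d d' : EdgeEnd G, rot.SameCycle d d' ↔ vert d = vert d'

/-- Face tracing: cross the edge to its opposite end, then turn to the next edge-end there. -/
def RotationSystem.facePerm {G : Graph α β} (R : RotationSystem G) : Equiv.Perm (EdgeEnd G) :=
  (EdgeEnd.flip G).trans R.rot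

/-- The number of faces of the embedding: the cycles of the face-tracing permutation (fixed points
included); a vertex without edges (which in a connected graph is the whole graph, embedded in the
sphere) accounts for one further face. -/
noncomputable def RotationSystem.numFaces {G : Graph α β} (R : RotationSystem G) : ℕ :=
  Nat.card (Quotient (Equiv.Perm.SameCycle.setoid R.facePerm)) +
    {x | x ∈ G.vertexSet ∧ ∀ e, ¬ G.Inc e x}.ncard

/-- `G` is upper-embeddable: it has a 2-cell embedding with one or two faces in some orientable
surface (so in particular `G` is connected). -/
def UpperEmbeddable (G : Graph α β) : Prop :=
  IsConnected G ∧ ∃ R : RotationSystem G, R.numFaces = 1 ∨ R.numFaces = 2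

/-- Vertices of `H₃`: three free nodes; the parts `mid` (three 2-valent vertices) and `hub`
(two 3-valent vertices) of `K_{2,3}`. -/
inductive H3Vertex where
  | free (i : Fin 3)
  | mid (i : Fin 3)
  | hub (j : Fin 2)

/-- Edges of `H₃`: three free edges and the six edges of `K_{2,3}`. -/
inductive H3Edge where
  | free (i : Fin 3)
  | spoke (i : Fin 3) (j : Fin 2)

/-- The two ends of an edge of `H₃`. -/
def H3Edge.ends : H3Edge → Sym2 H3Vertex
  | .free i => s(.free i, .mid i)
  | .spoke i j => s(.mid i, .hub j)

/-- The graph `H₃`: `K_{2,3}` with a pendant vertex (free node) attached to each of its three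
2-valent vertices. -/
def H3 : Graph H3Vertex H3Edge where
  vertexSet := Set.univ
  edgeSet := Set.univ
  IsLink e x y := e.ends = s(x, y)
  isLink_symm _ _ := ⟨fun _ _ h => h.trans Sym2.eq_swap⟩
  eq_or_eq_of_isLink_of_isLink e x y v w h h' := by
    rw [h, Sym2.eq_iff] at h'
    tauto
  edge_mem_iff_exists_isLink e := by
    refine ⟨fun _ => ?_, fun _ => Set.mem_univ _⟩
    induction h : e.ends with
    | _ x y => exact ⟨x, y, rfl⟩
  left_mem_of_isLink _ _ _ _ := Set.mem_univ _

/-- A family `T_n` of `n` triples of distinct 2-valent vertices of `G`. Each triple is listed in an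
arbitrary order (`H₃` is symmetric under permutations of its free nodes); different triples may
share vertices. -/
structure Triples (G : Graph α β) (n : ℕ) where
  /-- The `j`-th vertex of the triple `t_i`. -/
  vert : Fin n → Fin 3 → α
  mem : ∀ i j, vert i j ∈ G.vertexSet
  injective : ∀ i, Function.Injective (vert i)
  valence_eq : ∀ i j, valence G (vert i j) = 2

/-- Vertices for the graph `H(G, T_n)`: those of `G`, and the non-free ones of each copy of `H₃`. -/
abbrev ScaffoldVertex (α : Type*) (n : ℕ) : Type _ := α ⊕ Fin n × {x : H3Vertex // ∀ j, x ≠ .free j}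

/-- The `i`-th copy of `H₃` in `H(G, T_n)`: its free nodes are identified with the vertices of the
triple `t_i`, its other vertices are new. -/
def Triples.glue {G : Graph α β} {n : ℕ} (T : Triples G n) (i : Fin n) :
    H3Vertex → ScaffoldVertex α n
  | .free j => .inl (T.vert i j)
  | .mid j => .inr (i, ⟨.mid j, fun _ h => H3Vertex.noConfusion h⟩)
  | .hub j => .inr (i, ⟨.hub j, fun _ h => H3Vertex.noConfusion h⟩)

/-- The incidences of `H(G, T_n)`: edges of `G` keep their ends, edges of the `i`-th copy of `H₃`
join the (glued) images of their ends. -/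
def Triples.IsLink {G : Graph α β} {n : ℕ} (T : Triples G n) :
    β ⊕ Fin n × H3Edge → ScaffoldVertex α n → ScaffoldVertex α n → Prop
  | .inl e, x, y => ∃ a b, G.IsLink e a b ∧ x = .inl a ∧ y = .inl b
  | .inr (i, e), x, y => ∃ a b, H3.IsLink e a b ∧ x = T.glue i a ∧ y = T.glue i b

/-- The scaffolded graph `H(G, T_n)`: the disjoint union of `G` and `n` copies of `H₃`, with the
free nodes of the `i`-th copy identified with the vertices of the triple `t_i`. -/
def scaffoldedGraph (G : Graph α β) {n : ℕ} (T : Triples G n) :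
    Graph (ScaffoldVertex α n) (β ⊕ Fin n × H3Edge) where
  vertexSet := Sum.inl '' G.vertexSet ∪ Set.range Sum.inr
  IsLink := T.IsLink
  isLink_symm e _ := by
    refine ⟨fun x y h => ?_⟩
    rcases e with e | ⟨i, e⟩ <;> obtain ⟨a, b, h, hx, hy⟩ := h <;> exact ⟨b, a, h.symm, hy, hx⟩
  eq_or_eq_of_isLink_of_isLink e x y v w h h' := by
    rcases e with e | ⟨i, e⟩ <;> obtain ⟨a, b, h, rfl, rfl⟩ := h <;>
      obtain ⟨c, d, h', rfl, rfl⟩ := h' <;> rcases h.left_eq_or_eq h' with rfl | rfl <;> simp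
  left_mem_of_isLink e x y h := by
    rcases e with e | ⟨i, e⟩
    · obtain ⟨a, b, h, rfl, rfl⟩ := h
      exact Or.inl ⟨a, h.left_mem, rfl⟩
    · obtain ⟨a, b, h, rfl, rfl⟩ := h
      cases a with
      | free j => exact Or.inl ⟨_, T.mem i j, rfl⟩
      | mid j => exact Or.inr ⟨_, rfl⟩
      | hub j => exact Or.inr ⟨_, rfl⟩

end Scaffold

/-! Faces are the cycles of `σ * α`, where `σ` rotates darts (edge-ends) at vertices and `α` flips
edges. Splicing a dart `d` into the rotation next to `a` replaces `σ` by `swap a d * σ`, so it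
multiplies the face permutation by a transposition: it merges two faces if `a` and `d` lie on
different ones and otherwise adds at most one face.

All darts of the scaffolded graph are present from the start. Initially `σ` is the given rotation on
`G` and fixes every dart of the copies of `H₃`, so each of their `9 * n` edges floats freely and has
a face of its own. The copies are then attached one by one, and each has to lower the count by `9`.
Its five new vertices are reached by five pendant edges, each merging away one face. The other four
edges form two pairs sharing a 2-valent vertex of `K_{2,3}`, and each pair lowers the count by two:
if closing the first edge of a pair splits a face, both resulting faces appear at the common vertex,
so the second edge can be closed by a merge (Xuong's argument). Hence the final embedding has at
most as many faces as that of `G`, and connectedness leaves one or two. -/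

namespace Scaffold

/-! ### Cycle counts under multiplication by a transposition -/

section Cycles

variable {D : Type*} {φ : Equiv.Perm D} {a b : D}

/-- The number of cycles of a permutation, fixed points included. -/
noncomputable def numCycles (φ : Equiv.Perm D) : ℕ :=
  Nat.card (Quotient (Equiv.Perm.SameCycle.setoid φ))

/-- Being in the same cycle is the least equivalence relation linking each point to its image, so it
suffices to check one step. This yields every invariant of cycles used below. -/
theorem sameCycle_le_setoid (s : Setoid D) (h : ∀ x, s x (φ x)) {x y : D}
    (hxy : φ.SameCycle x y) : s x y := by
  have key : ∀ (k : ℕ) (z : D), s z ((φ ^ k) z) := by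
    intro k
    induction k with
    | zero => exact fun z => s.refl z
    | succ k ih =>
      intro z
      rw [pow_succ']
      exact s.trans (ih z) (h _)
  obtain ⟨k, rfl⟩ := hxy
  cases k with
  | ofNat k => simpa using key k x
  | negSucc k =>
    have := key (k + 1) ((φ ^ (Int.negSucc k)) x)
    rw [← Equiv.Perm.mul_apply, zpow_negSucc, mul_inv_cancel, Equiv.Perm.one_apply] at this
    rw [zpow_negSucc]
    exact s.symm this

theorem sameCycle_map {D' : Type*} {τ : Equiv.Perm D'} {f : D → D'} (hf : ∀ d, τ (f d) = f (φ d))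
    {d d' : D} (h : φ.SameCycle d d') : τ.SameCycle (f d) (f d') :=
  sameCycle_le_setoid (Setoid.comap f (Equiv.Perm.SameCycle.setoid τ))
    (fun z => ⟨1, by rw [zpow_one, hf]⟩) h

theorem swap_mul_swap_mul [DecidableEq D] (φ : Equiv.Perm D) (a b : D) :
    Equiv.swap a b * (Equiv.swap a b * φ) = φ := by
  rw [← mul_assoc, Equiv.swap_mul_self, one_mul]

theorem setoid_swap [DecidableEq D] (s : Setoid D) (hab : s a b) (x : D) :
    s x (Equiv.swap a b x) := by
  rw [Equiv.swap_apply_def]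
  split_ifs with h1 h2
  · exact h1 ▸ hab
  · exact h2 ▸ s.symm hab
  · exact s.refl x

variable [Finite D] [DecidableEq D]

/-- Multiplying by a transposition of points in different cycles joins these cycles. -/
theorem sameCycle_swap_mul (h : ¬ φ.SameCycle a b) : (Equiv.swap a b * φ).SameCycle a b := by
  have hp : 0 < Function.minimalPeriod φ a :=
    Function.minimalPeriod_pos_of_mem_periodicPts
      ((Function.Injective.mem_periodicPts φ.injective a))
  have hb : ∀ k : ℕ, (φ ^ k) a ≠ b := fun k hk => h ⟨k, by simpa using hk⟩
  -- Until the `φ`-orbit of `a` closes up it meets neither `a` nor `b`, so the swap does not act;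
  -- the closing step is redirected from `a` to `b`.
  have key : ∀ k : ℕ, k < Function.minimalPeriod φ a →
      ((Equiv.swap a b * φ) ^ k) a = (φ ^ k) a := by
    intro k
    induction k with
    | zero => simp
    | succ k ih =>
      intro hk
      rw [pow_succ', Equiv.Perm.mul_apply, ih (by omega), Equiv.Perm.mul_apply,
        ← Equiv.Perm.mul_apply φ, ← pow_succ']
      refine Equiv.swap_apply_of_ne_of_ne (fun h0 => ?_) (hb _)
      exact Function.not_isPeriodicPt_of_pos_of_lt_minimalPeriod (Nat.succ_ne_zero k) hk
        (by rwa [Function.IsPeriodicPt, Function.IsFixedPt, ← Equiv.Perm.coe_pow])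
  refine ⟨Function.minimalPeriod φ a, ?_⟩
  obtain ⟨m, hm⟩ := Nat.exists_eq_succ_of_ne_zero hp.ne'
  have h2 : (φ ^ (m + 1)) a = a := by
    have := Function.isPeriodicPt_minimalPeriod φ a
    rw [hm] at this
    rwa [Function.IsPeriodicPt, Function.IsFixedPt, ← Equiv.Perm.coe_pow] at this
  rw [zpow_natCast, hm, Nat.succ_eq_add_one, pow_succ', Equiv.Perm.mul_apply, key m (by omega),
    Equiv.Perm.mul_apply, ← Equiv.Perm.mul_apply φ, ← pow_succ', h2, Equiv.swap_apply_left]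

/-- Multiplying by a transposition of points in the same cycle splits this cycle. -/
theorem not_sameCycle_swap_mul (hab : a ≠ b) (h : φ.SameCycle a b) :
    ¬ (Equiv.swap a b * φ).SameCycle a b := by
  classical
  have hex : ∃ k : ℕ, (φ ^ k) a = b := by
    obtain ⟨k, -, hk⟩ := h.exists_pow_eq'
    exact ⟨k, hk⟩
  -- At the first time `k` the orbit reaches `b`, the swap sends it back to `a`, so the new cycle of
  -- `a` consists of points before `b`.
  obtain ⟨k, hk, hmin⟩ : ∃ k : ℕ, (φ ^ k) a = b ∧ ∀ j < k, (φ ^ j) a ≠ b :=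
    ⟨Nat.find hex, Nat.find_spec hex, fun j => Nat.find_min hex⟩
  have hk0 : k ≠ 0 := by
    rintro rfl
    exact hab hk
  have key : ∀ j : ℕ, j < k → ((Equiv.swap a b * φ) ^ j) a = (φ ^ j) a := by
    intro j
    induction j with
    | zero => simp
    | succ j ih =>
      intro hj
      rw [pow_succ', Equiv.Perm.mul_apply, ih (by omega), Equiv.Perm.mul_apply,
        ← Equiv.Perm.mul_apply φ, ← pow_succ']
      refine Equiv.swap_apply_of_ne_of_ne (fun h0 => ?_) (hmin _ hj)
      refine hmin (k - (j + 1)) (by omega) ?_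
      conv_lhs => rw [← h0]
      rw [← Equiv.Perm.mul_apply, ← pow_add, Nat.sub_add_cancel hj.le, hk]
  have hper : ((Equiv.swap a b * φ) ^ k) a = a := by
    obtain ⟨m, rfl⟩ := Nat.exists_eq_succ_of_ne_zero hk0
    rw [Nat.succ_eq_add_one, pow_succ', Equiv.Perm.mul_apply, key m (by omega),
      Equiv.Perm.mul_apply, ← Equiv.Perm.mul_apply φ, ← pow_succ', hk, Equiv.swap_apply_right]
  intro hs
  obtain ⟨m, -, hm⟩ := hs.exists_pow_eq'
  have hdiv : ((Equiv.swap a b * φ) ^ m) a = ((Equiv.swap a b * φ) ^ (m % k)) a := by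
    conv_lhs => rw [← Nat.mod_add_div m k, pow_add, pow_mul, Equiv.Perm.mul_apply]
    rw [Equiv.Perm.pow_apply_eq_self_of_apply_eq_self hper]
  have hlt := Nat.mod_lt m (Nat.pos_of_ne_zero hk0)
  rw [hdiv, key _ hlt] at hm
  exact hmin _ hlt hm

theorem SameCycle.swap_mul_of_not (h : ¬ φ.SameCycle a b) {x y : D} (hxy : φ.SameCycle x y) :
    (Equiv.swap a b * φ).SameCycle x y := by
  refine sameCycle_le_setoid (Equiv.Perm.SameCycle.setoid (Equiv.swap a b * φ)) (fun z => ?_) hxy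
  have h1 : (Equiv.swap a b * φ).SameCycle z (Equiv.swap a b (φ z)) := ⟨1, rfl⟩
  have h2 := setoid_swap (Equiv.Perm.SameCycle.setoid (Equiv.swap a b * φ))
    (sameCycle_swap_mul h) (φ z)
  exact Setoid.trans' _ h1 (Setoid.symm' _ h2)

/-- Old cycles map onto new ones; with equal counts this map would be injective, yet it identifies
the cycles of `a` and `b`. -/
theorem numCycles_swap_mul_lt (h : ¬ φ.SameCycle a b) :
    numCycles (Equiv.swap a b * φ) < numCycles φ := by
  classical
  have := Fintype.ofFinite D
  let f : Quotient (Equiv.Perm.SameCycle.setoid φ) →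
      Quotient (Equiv.Perm.SameCycle.setoid (Equiv.swap a b * φ)) :=
    Quotient.map' id fun x y hxy => SameCycle.swap_mul_of_not h hxy
  have hf : Function.Surjective f := by
    rintro ⟨x⟩
    exact ⟨Quotient.mk _ x, rfl⟩
  unfold numCycles
  refine lt_of_le_of_ne (Nat.card_le_card_of_surjective f hf) fun heq => h ?_
  have hi := ((Nat.bijective_iff_surjective_and_card f).2 ⟨hf, heq.symm⟩).1
  exact Quotient.exact (hi (a₁ := Quotient.mk _ a) (a₂ := Quotient.mk _ b)
    (Quotient.sound (sameCycle_swap_mul h)))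

theorem numCycles_le_swap_mul_add_one (φ : Equiv.Perm D) (a b : D) :
    numCycles φ ≤ numCycles (Equiv.swap a b * φ) + 1 := by
  classical
  by_cases h : φ.SameCycle a b
  · by_cases hab : a = b
    · subst hab
      simp [← Equiv.Perm.one_def]
    · have := numCycles_swap_mul_lt (not_sameCycle_swap_mul hab h)
      rw [swap_mul_swap_mul] at this
      omega
  · let mk : D → Quotient (Equiv.Perm.SameCycle.setoid φ) := Quotient.mk _
    -- Relabelling the cycle of `b` as that of `a` gives an invariant of the new cycles, so only
    -- these two cycles can have been merged.
    let g : D → Quotient (Equiv.Perm.SameCycle.setoid φ) :=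
      fun x => if mk x = mk b then mk a else mk x
    have hφ : ∀ x, mk (φ x) = mk x := fun x => Quotient.sound
      (show φ.SameCycle (φ x) x from Equiv.Perm.SameCycle.symm ⟨1, rfl⟩)
    have hg : ∀ x y, (Equiv.swap a b * φ).SameCycle x y → g x = g y := by
      intro x y hxy
      refine sameCycle_le_setoid (Setoid.ker g) (fun z => ?_) hxy
      have h1 : g z = g (φ z) := by simp only [g, hφ]
      have h2 : (Setoid.ker g) (φ z) (Equiv.swap a b (φ z)) :=
        setoid_swap (Setoid.ker g) (by simp [Setoid.ker_def, g]) (φ z)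
      exact h1.trans h2
    let f : Quotient (Equiv.Perm.SameCycle.setoid φ) →
        Option (Quotient (Equiv.Perm.SameCycle.setoid (Equiv.swap a b * φ))) :=
      fun q => if q = mk b then none else
        some (Quotient.map' id (fun x y hxy => SameCycle.swap_mul_of_not h hxy) q)
    have hf : Function.Injective f := by
      rintro ⟨x⟩ ⟨y⟩ hxy
      change f (mk x) = f (mk y) at hxy
      change mk x = mk y
      simp only [f] at hxy
      split_ifs at hxy with h1 h2 h2
      · exact h1.trans h2.symm
      · have := hg x y (Quotient.exact (Option.some.inj hxy))
        simpa [g, h1, h2] using this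
    have := Nat.card_le_card_of_injective f hf
    rwa [Finite.card_option] at this

theorem numCycles_swap_mul_le (φ : Equiv.Perm D) (a b : D) :
    numCycles (Equiv.swap a b * φ) ≤ numCycles φ + 1 := by
  simpa only [swap_mul_swap_mul] using numCycles_le_swap_mul_add_one (Equiv.swap a b * φ) a b

end Cycles

end Scaffold


namespace Scaffold

/-! ### Attaching edges to a partial rotation -/

section Attaching

variable {D V : Type*} {σ α : Equiv.Perm D} {v : D → V} {S : Set D} {a d : D}

/-- `σ` is a rotation of the darts in `S`, which lie at the vertices given by `v`; each dart outside
`S` is alone at a vertex of its own. -/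
def IsRotationOn (v : D → V) (S : Set D) (σ : Equiv.Perm D) : Prop :=
  ∀ x y, σ.SameCycle x y ↔ x = y ∨ x ∈ S ∧ y ∈ S ∧ v x = v y

theorem IsRotationOn.apply_eq_self (h : IsRotationOn v S σ) (hd : d ∉ S) : σ d = d := by
  rcases (h d (σ d)).1 ⟨1, rfl⟩ with h1 | h1
  · exact h1.symm
  · exact absurd h1.1 hd

theorem IsRotationOn.insert_of_forall_ne (h : IsRotationOn v S σ) (hne : ∀ a ∈ S, v a ≠ v d) :
    IsRotationOn v (insert d S) σ := by
  intro x y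
  rw [h]
  constructor
  · rintro (h | ⟨h1, h2, h3⟩)
    · exact Or.inl h
    · exact Or.inr ⟨Or.inr h1, Or.inr h2, h3⟩
  · rintro (h | ⟨rfl | h1, rfl | h2, h3⟩)
    · exact Or.inl h
    · exact Or.inl rfl
    · exact absurd h3.symm (hne _ h2)
    · exact absurd h3 (hne _ h1)
    · exact Or.inr ⟨h1, h2, h3⟩

/-- Since `d` is a fixed point of `σ`, the swap splices it into the cycle of `a`, just before `a`.
-/
theorem IsRotationOn.insert_of_eq [Finite D] [DecidableEq D] (h : IsRotationOn v S σ) (hd : d ∉ S)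
    (ha : a ∈ S) (hv : v a = v d) : IsRotationOn v (insert d S) (Equiv.swap a d * σ) := by
  have had : ¬ σ.SameCycle a d := by
    rw [h]
    rintro (rfl | h1)
    · exact hd ha
    · exact hd h1.2.1
  have hjoin := sameCycle_swap_mul had
  have key : ∀ x ∈ insert d S, v x = v d → (Equiv.swap a d * σ).SameCycle x d := by
    rintro x (rfl | hx) hxd
    · exact Equiv.Perm.SameCycle.refl _ _
    · exact (SameCycle.swap_mul_of_not had ((h x a).2 (Or.inr ⟨hx, ha, hxd.trans hv.symm⟩))).trans
        hjoin
  intro x y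
  constructor
  · let s : Setoid D :=
      { r := fun x y => x = y ∨ x ∈ insert d S ∧ y ∈ insert d S ∧ v x = v y
        iseqv :=
          { refl := fun x => Or.inl rfl
            symm := by
              rintro x y (rfl | ⟨h1, h2, h3⟩)
              · exact Or.inl rfl
              · exact Or.inr ⟨h2, h1, h3.symm⟩
            trans := by
              rintro x y z (rfl | ⟨h1, h2, h3⟩) (rfl | ⟨h4, h5, h6⟩)
              · exact Or.inl rfl
              · exact Or.inr ⟨h4, h5, h6⟩
              · exact Or.inr ⟨h1, h2, h3⟩
              · exact Or.inr ⟨h1, h5, h3.trans h6⟩ } }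
    refine fun hxy => sameCycle_le_setoid s (fun z => ?_) hxy
    refine s.trans ?_ (setoid_swap s (Or.inr ⟨Or.inr ha, Or.inl rfl, hv⟩) (σ z))
    rcases (h z (σ z)).1 ⟨1, rfl⟩ with h1 | ⟨h1, h2, h3⟩
    · exact Or.inl h1
    · exact Or.inr ⟨Or.inr h1, Or.inr h2, h3⟩
  · rintro (rfl | ⟨h1, h2, h3⟩)
    · exact Equiv.Perm.SameCycle.refl _ _
    · by_cases hx : v x = v d
      · exact (key x h1 hx).trans (key y h2 (h3.symm.trans hx)).symm
      · refine SameCycle.swap_mul_of_not had ((h x y).2 (Or.inr ⟨?_, ?_, h3⟩))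
        · exact h1.resolve_left fun h0 => hx (by rw [h0])
        · exact h2.resolve_left fun h0 => hx (by rw [h3, h0])

/-- An edge both of whose ends are alone is surrounded by a face of its own. -/
theorem IsRotationOn.not_sameCycle (h : IsRotationOn v S σ) (hα : ∀ x, α (α x) = x)
    (hd : d ∉ S) (hd' : α d ∉ S) {x : D} (h1 : x ≠ d) (h2 : x ≠ α d) :
    ¬ (σ * α).SameCycle x d := by
  intro hs
  -- The pair `{d, α d}` is invariant under `σ * α`, as `σ` fixes both darts.
  have := sameCycle_le_setoid (Setoid.ker fun x => x = d ∨ x = α d) (fun z => ?_) hs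
  · have h3 : (x = d ∨ x = α d) = (d = d ∨ d = α d) := this
    simp [h1, h2] at h3
  · change (z = d ∨ z = α d) = (σ (α z) = d ∨ σ (α z) = α d)
    have e1 := h.apply_eq_self hd
    have e2 := h.apply_eq_self hd'
    refine propext ⟨?_, ?_⟩
    · rintro (rfl | rfl)
      · exact Or.inr e2
      · exact Or.inl (by rw [hα, e1])
    · rintro (h3 | h3)
      · exact Or.inr (by rw [← hα z, σ.injective (h3.trans e1.symm)])
      · exact Or.inl (α.injective (σ.injective (h3.trans e2.symm)))

/-- The darts in `S` can be rotated at their vertices so that there are at most `N` faces, where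
edges with no end in `S` count as components of their own. -/
def HasRotation (α : Equiv.Perm D) (v : D → V) (S : Set D) (N : ℕ) : Prop :=
  ∃ σ : Equiv.Perm D, IsRotationOn v S σ ∧ numCycles (σ * α) ≤ N

variable [Finite D] {N : ℕ}

/-- Attaching a pendant edge joins its face to another one. -/
theorem HasRotation.insert_pendant (hα : ∀ x, α (α x) = x) (h : HasRotation α v S (N + 1))
    (hd : d ∉ S) (hd' : α d ∉ S) (ha : a ∈ S) (hv : v a = v d)
    (hne : ∀ x ∈ S, v x ≠ v (α d)) (hloop : v d ≠ v (α d)) :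
    HasRotation α v (insert (α d) (insert d S)) N := by
  classical
  obtain ⟨σ, hσ, hN⟩ := h
  refine ⟨Equiv.swap a d * σ, (hσ.insert_of_eq hd ha hv).insert_of_forall_ne ?_, ?_⟩
  · rintro x (rfl | hx)
    · exact hloop
    · exact hne x hx
  · have := numCycles_swap_mul_lt (hσ.not_sameCycle hα hd hd' (x := a)
      (fun h0 => hd (h0 ▸ ha)) (fun h0 => hd' (h0 ▸ ha)))
    rw [← mul_assoc] at this
    omega

/-- Two edges with a common end can be attached without changing the number of the other faces. -/
theorem HasRotation.insert_adjacent_pair (hα : ∀ x, α (α x) = x) (h : HasRotation α v S (N + 2))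
    {c d : D} (hc : c ∉ S) (hc' : α c ∉ S) (hd : d ∉ S) (hd' : α d ∉ S)
    (hcα : α c ≠ c) (hdα : α d ≠ d) (hcd : c ≠ d) (hcd' : c ≠ α d)
    (ha : a ∈ S) (hac : v a = v c) (had : v a = v d)
    {y z : D} (hy : y ∈ S) (hyc : v y = v (α c)) (hz : z ∈ S) (hzd : v z = v (α d)) :
    HasRotation α v (insert d (insert (α c) (insert (α d) (insert c S)))) N := by
  classical
  obtain ⟨σ, hσ, hN⟩ := h
  have hdc' : d ≠ α c := fun h0 => hcd' (by rw [h0, hα])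
  have hdc'' : α d ≠ α c := fun h0 => hcd (α.injective h0.symm)
  have ne_of : ∀ {x w : D}, x ∈ S → w ∉ S → x ≠ w := fun hx hw h0 => hw (h0 ▸ hx)
  -- Each edge is first hung by one end, `c` at the common vertex and `α d` at the far vertex of the
  -- other edge; both steps are merges and use up the `2`.
  have hσ1 := hσ.insert_of_eq hc ha hac
  have hN1 := numCycles_swap_mul_lt (hσ.not_sameCycle hα hc hc' (ne_of ha hc) (ne_of ha hc'))
  rw [← mul_assoc] at hN1
  set σ1 := Equiv.swap a c * σ
  have hd1 : d ∉ insert c S := by simp [hd, hcd.symm]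
  have hd1' : α d ∉ insert c S := by simp [hd', hcd'.symm]
  have hσ2 := hσ1.insert_of_eq hd1' (Or.inr hz) hzd
  have hN2 := numCycles_swap_mul_lt (hσ1.not_sameCycle (x := z) hα (d := α d) hd1'
    (by rwa [hα]) (ne_of hz hd') (by rw [hα]; exact ne_of hz hd))
  rw [← mul_assoc] at hN2
  set σ2 := Equiv.swap z (α d) * σ1
  have hc2' : α c ∉ insert (α d) (insert c S) := by simp [hc', hcα, hdc''.symm]
  have hd2 : d ∉ insert (α d) (insert c S) := by simp [hd, hdα.symm, hcd.symm]
  have hσ3 := hσ2.insert_of_eq hc2' (Or.inr (Or.inr hy)) hyc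
  have hN3 := numCycles_swap_mul_le (σ2 * α) y (α c)
  have hfix : σ2 (α c) = α c := hσ2.apply_eq_self hc2'
  -- It remains to insert `α c` and `d` with no net gain. If the first insertion splits a face, the
  -- second must merge.
  by_cases hs : (σ2 * α).SameCycle y (α c)
  · have hsplit := not_sameCycle_swap_mul (ne_of hy hc') hs
    rw [← mul_assoc] at hN3 hsplit
    set σ3 := Equiv.swap y (α c) * σ2 with hσ3def
    have hd3 : d ∉ insert (α c) (insert (α d) (insert c S)) := by
      simp [hd, hdα.symm, hcd.symm, hdc']
    have hcy : (σ3 * α).SameCycle c y := by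
      refine ⟨1, ?_⟩
      simp [hσ3def, hfix]
    have hcc : (σ3 * α).SameCycle (α c) (σ3 c) := by
      refine ⟨1, ?_⟩
      simp [hα]
    -- The two sides of the edge of `c` now lie on different faces, so of the darts `c` and `σ3 c`
    -- at the common vertex, at least one is not on the face of `d`.
    have hnot : ¬ (σ3 * α).SameCycle c (σ3 c) := fun h0 =>
      hsplit (hcy.symm.trans (h0.trans hcc.symm))
    have hc3 : c ∈ insert (α c) (insert (α d) (insert c S)) := by simp
    obtain ⟨x, hx, hxv, hxd⟩ : ∃ x ∈ insert (α c) (insert (α d) (insert c S)),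
        v x = v d ∧ ¬ (σ3 * α).SameCycle x d := by
      by_cases h0 : (σ3 * α).SameCycle c d
      · refine ⟨σ3 c, ?_, ?_, fun h1 => hnot (h0.trans h1.symm)⟩
        · rcases (hσ3 c (σ3 c)).1 ⟨1, rfl⟩ with h2 | h2
          · exact h2 ▸ hc3
          · exact h2.2.1
        · rcases (hσ3 c (σ3 c)).1 ⟨1, rfl⟩ with h2 | h2
          · rw [← h2, ← hac, had]
          · rw [← h2.2.2, ← hac, had]
      · exact ⟨c, hc3, hac.symm.trans had, h0⟩
    refine ⟨_, hσ3.insert_of_eq hd3 hx hxv, ?_⟩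
    have hN4 := numCycles_swap_mul_lt hxd
    rw [← mul_assoc] at hN4
    omega
  -- Here the first insertion merges, which pays for whatever the second does.
  · have hN3' := numCycles_swap_mul_lt hs
    rw [← mul_assoc] at hN3'
    refine ⟨_, hσ3.insert_of_eq (by simp [hd, hdα.symm, hcd.symm, hdc'])
      (Or.inr (Or.inr (Or.inr ha))) had, ?_⟩
    have hN4 := numCycles_swap_mul_le (Equiv.swap y (α c) * σ2 * α) a d
    rw [← mul_assoc] at hN4
    omega

end Attaching

/-! ### The same moves, stated for sets of edges -/

section Edges

variable {E V : Type*} [Finite E] {v : E × Bool → V} {F : Set E} {N : ℕ}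

/-- `HasRotation` for the darts of the edges in `F`. -/
def EdgesHaveRotation (v : E × Bool → V) (F : Set E) (N : ℕ) : Prop :=
  HasRotation ((Equiv.refl E).prodCongr Equiv.boolNot) v {d | d.1 ∈ F} N

theorem EdgesHaveRotation.insert_pendant (h : EdgesHaveRotation v F (N + 1)) {e : E} (he : e ∉ F)
    (ha : ∃ a : E × Bool, a.1 ∈ F ∧ v a = v (e, false))
    (hne : ∀ a : E × Bool, a.1 ∈ F → v a ≠ v (e, true)) :
    EdgesHaveRotation v (insert e F) N := by
  obtain ⟨a, ha, hv⟩ := ha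
  have := HasRotation.insert_pendant (d := (e, false)) (by simp) h (by simpa) (by simpa) ha hv
    (by simpa using hne) (by rw [← hv]; exact hne a ha)
  unfold EdgesHaveRotation
  convert this using 1
  ext ⟨x, b⟩
  cases b <;> simp

theorem EdgesHaveRotation.insert_adjacent_pair (h : EdgesHaveRotation v F (N + 2)) {e e' : E}
    (he : e ∉ F) (he' : e' ∉ F) (hee' : e ≠ e') (hv : v (e, false) = v (e', false))
    (ha : ∃ a : E × Bool, a.1 ∈ F ∧ v a = v (e, false))
    (hy : ∃ a : E × Bool, a.1 ∈ F ∧ v a = v (e, true))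
    (hz : ∃ a : E × Bool, a.1 ∈ F ∧ v a = v (e', true)) :
    EdgesHaveRotation v (insert e' (insert e F)) N := by
  obtain ⟨a, ha, hav⟩ := ha
  obtain ⟨y, hy, hyv⟩ := hy
  obtain ⟨z, hz, hzv⟩ := hz
  have := HasRotation.insert_adjacent_pair (c := (e, false)) (d := (e', false))
    (by simp) h (by simpa) (by simpa) (by simpa) (by simpa) (by simp) (by simp)
    (by simpa) (by simp) ha hav (hav.trans hv) hy hyv hz hzv
  unfold EdgesHaveRotation
  convert this using 1
  ext ⟨x, b⟩
  cases b <;> simp [or_left_comm]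

end Edges

end Scaffold


/-! ### Attaching the copies of `H₃` -/

namespace Scaffold

/-- The two ends of an edge of `H₃`, in a fixed order. -/
def H3Edge.endAt : H3Edge → Bool → H3Vertex
  | .free i, false => .free i
  | .free i, true => .mid i
  | .spoke i _, false => .mid i
  | .spoke _ j, true => .hub j

theorem H3Edge.ends_eq (e : H3Edge) : e.ends = s(e.endAt false, e.endAt true) := by
  cases e <;> rfl

/-- `H3Edge` as a type of known cardinality. -/
def H3Edge.equivSum : H3Edge ≃ Fin 3 ⊕ Fin 3 × Fin 2 where
  toFun
    | .free i => .inl i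
    | .spoke i j => .inr (i, j)
  invFun
    | .inl i => .free i
    | .inr (i, j) => .spoke i j
  left_inv e := by cases e <;> rfl
  right_inv e := by rcases e with e | e <;> rfl

instance : Finite H3Edge := Finite.of_equiv _ H3Edge.equivSum.symm

theorem H3Edge.card : Nat.card H3Edge = 9 := by
  rw [Nat.card_congr H3Edge.equivSum]
  simp

variable {α β : Type*} {G : Graph α β} {n : ℕ}

section Rotation

variable (R : RotationSystem G) (T : Triples G n)

/-- The vertex of the scaffolded graph at which an end of an edge lies. -/
def scaffoldVert : (G.edgeSet ⊕ Fin n × H3Edge) × Bool → ScaffoldVertex α n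
  | (.inl e, b) => .inl (R.vert (e, b))
  | (.inr (i, e), b) => T.glue i (e.endAt b)

variable {R T}

/-- The `9` is spent as `1 + 1 + 1 + 1 + 1 + 2 + 2`: the free edges and the spokes at `mid 0` are
pendant when added and reach all new vertices; the spokes at `mid 1` and at `mid 2` are then
adjacent pairs ending at the hubs. -/
theorem EdgesHaveRotation.union_copy [Finite G.edgeSet] {N : ℕ}
    {F : Set (G.edgeSet ⊕ Fin n × H3Edge)} {i : Fin n}
    (h : EdgesHaveRotation (scaffoldVert R T) F (N + 9))
    (hT : ∀ j, ∃ d, R.vert d = T.vert i j)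
    (hG : ∀ e, Sum.inl e ∈ F) (hi : ∀ e, Sum.inr (i, e) ∉ F) :
    EdgesHaveRotation (scaffoldVert R T) (F ∪ Set.range fun e => Sum.inr (i, e)) N := by
  have hne : ∀ a b, a ∈ F → ∀ w, scaffoldVert R T (a, b) ≠ Sum.inr (i, w) := by
    rintro (e | ⟨i', e⟩) b ha w
    · simp [scaffoldVert]
    · have hi' : i' ≠ i := fun h0 => hi e (h0 ▸ ha)
      rcases e with j | ⟨j, k⟩ <;> cases b <;>
        simp [scaffoldVert, H3Edge.endAt, Triples.glue, hi']
  have hfree : ∀ j, ∃ a ∈ F, ∃ b,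
      scaffoldVert R T (a, b) = scaffoldVert R T (.inr (i, .free j), false) := by
    intro j
    obtain ⟨⟨e, b⟩, hd⟩ := hT j
    exact ⟨.inl e, hG e, b, by simp [scaffoldVert, H3Edge.endAt, Triples.glue, hd]⟩
  have h1 := h.insert_pendant (e := .inr (i, .free 0)) (hi _)
    (by obtain ⟨a, ha, b, hab⟩ := hfree 0; exact ⟨(a, b), ha, hab⟩)
    (by rintro ⟨a, b⟩ ha; exact hne a b ha _)
  have h2 := h1.insert_pendant (e := .inr (i, .free 1)) (by simp [hi])
    (by obtain ⟨a, ha, b, hab⟩ := hfree 1; exact ⟨(a, b), by simp [ha], hab⟩)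
    (by
      rintro ⟨a, b⟩ (rfl | ha)
      · cases b <;> simp [scaffoldVert, H3Edge.endAt, Triples.glue, Subtype.ext_iff]
      · exact hne a b ha _)
  have h3 := h2.insert_pendant (e := .inr (i, .free 2)) (by simp [hi])
    (by obtain ⟨a, ha, b, hab⟩ := hfree 2; exact ⟨(a, b), by simp [ha], hab⟩)
    (by
      rintro ⟨a, b⟩ (rfl | rfl | ha)
      · cases b <;> simp [scaffoldVert, H3Edge.endAt, Triples.glue, Subtype.ext_iff]
      · cases b <;> simp [scaffoldVert, H3Edge.endAt, Triples.glue, Subtype.ext_iff]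
      · exact hne a b ha _)
  have h4 := h3.insert_pendant (e := .inr (i, .spoke 0 0)) (by simp [hi])
    ⟨(.inr (i, .free 0), true), by simp, rfl⟩
    (by
      rintro ⟨a, b⟩ (rfl | rfl | rfl | ha)
      · cases b <;> simp [scaffoldVert, H3Edge.endAt, Triples.glue, Subtype.ext_iff]
      · cases b <;> simp [scaffoldVert, H3Edge.endAt, Triples.glue, Subtype.ext_iff]
      · cases b <;> simp [scaffoldVert, H3Edge.endAt, Triples.glue, Subtype.ext_iff]
      · exact hne a b ha _)
  have h5 := h4.insert_pendant (e := .inr (i, .spoke 0 1)) (by simp [hi])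
    ⟨(.inr (i, .free 0), true), by simp, rfl⟩
    (by
      rintro ⟨a, b⟩ (rfl | rfl | rfl | rfl | ha)
      · cases b <;> simp [scaffoldVert, H3Edge.endAt, Triples.glue, Subtype.ext_iff]
      · cases b <;> simp [scaffoldVert, H3Edge.endAt, Triples.glue, Subtype.ext_iff]
      · cases b <;> simp [scaffoldVert, H3Edge.endAt, Triples.glue, Subtype.ext_iff]
      · cases b <;> simp [scaffoldVert, H3Edge.endAt, Triples.glue, Subtype.ext_iff]
      · exact hne a b ha _)
  have h6 := h5.insert_adjacent_pair (e := .inr (i, .spoke 1 0)) (e' := .inr (i, .spoke 1 1))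
    (by simp [hi]) (by simp [hi]) (by simp) rfl ⟨(.inr (i, .free 1), true), by simp, rfl⟩
    ⟨(.inr (i, .spoke 0 0), true), by simp, rfl⟩ ⟨(.inr (i, .spoke 0 1), true), by simp, rfl⟩
  have h7 := h6.insert_adjacent_pair (e := .inr (i, .spoke 2 0)) (e' := .inr (i, .spoke 2 1))
    (by simp [hi]) (by simp [hi]) (by simp) rfl ⟨(.inr (i, .free 2), true), by simp, rfl⟩
    ⟨(.inr (i, .spoke 0 0), true), by simp, rfl⟩ ⟨(.inr (i, .spoke 0 1), true), by simp, rfl⟩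
  convert h7 using 1
  ext x
  constructor
  · rintro (hx | ⟨j | ⟨j, k⟩, rfl⟩)
    · simp [hx]
    · fin_cases j <;> simp
    · fin_cases j <;> fin_cases k <;> simp
  · simp only [Set.mem_insert_iff]
    rintro (rfl | rfl | rfl | rfl | rfl | rfl | rfl | rfl | rfl | hx)
    on_goal 10 => exact Or.inl hx
    all_goals exact Or.inr ⟨_, rfl⟩

theorem EdgesHaveRotation.all_copies [Finite G.edgeSet]
    (hT : ∀ i j, ∃ d, R.vert d = T.vert i j) (s : Finset (Fin n)) (N : ℕ)
    (h : EdgesHaveRotation (scaffoldVert R T) (Set.range Sum.inl) (N + 9 * s.card)) :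
    EdgesHaveRotation (scaffoldVert R T)
      (Set.range Sum.inl ∪ {x | ∃ i ∈ s, ∃ e, x = Sum.inr (i, e)}) N := by
  classical
  induction s using Finset.induction_on generalizing N with
  | empty => simpa using h
  | insert i s his ih =>
    rw [Finset.card_insert_of_notMem his] at h
    have := (ih (N + 9) (by convert h using 1; ring)).union_copy (hT i) (by simp) (by simp [his])
    convert this using 1
    ext x
    rcases x with x | ⟨j, e⟩ <;> simp [or_comm, eq_comm]

/-- With all copies of `H₃` detached, each of their edges has one face. -/
theorem edgesHaveRotation_base [Finite G.edgeSet] :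
    EdgesHaveRotation (scaffoldVert R T) (Set.range Sum.inl)
      (numCycles R.facePerm + n * 9) := by
  let ι : EdgeEnd G → (G.edgeSet ⊕ Fin n × H3Edge) × Bool := fun d => (.inl d.1, d.2)
  let ε := Equiv.sumProdDistrib G.edgeSet (Fin n × H3Edge) Bool
  let σ : Equiv.Perm ((G.edgeSet ⊕ Fin n × H3Edge) × Bool) :=
    (ε.trans (Equiv.sumCongr R.rot (Equiv.refl _))).trans ε.symm
  have hι : ∀ d, σ (ι d) = ι (R.rot d) := fun d => rfl
  refine ⟨σ, ?_, ?_⟩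
  · intro x y
    constructor
    · intro hxy
      let f : (G.edgeSet ⊕ Fin n × H3Edge) × Bool → α ⊕ (Fin n × H3Edge) × Bool
        | (.inl e, b) => .inl (R.vert (e, b))
        | (.inr e, b) => .inr (e, b)
      have := sameCycle_le_setoid (Setoid.ker f) (fun z => ?_) hxy
      · have hf : f x = f y := this
        rcases x with ⟨e | e, b⟩ <;> rcases y with ⟨e' | e', b'⟩
        · exact Or.inr ⟨⟨e, rfl⟩, ⟨e', rfl⟩, by simpa [f, scaffoldVert] using hf⟩
        · simp [f] at hf
        · simp [f] at hf
        · left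
          simpa [f] using hf
      · rcases z with ⟨e | e, b⟩
        · have h1 : R.vert (e, b) = R.vert (R.rot (e, b)) :=
            (R.sameCycle_iff _ _).1 ⟨1, rfl⟩
          exact congrArg Sum.inl h1
        · rfl
    · rintro (rfl | ⟨⟨e, he⟩, ⟨e', he'⟩, hv⟩)
      · exact Equiv.Perm.SameCycle.refl _ _
      · rcases x with ⟨x, b⟩
        rcases y with ⟨y, b'⟩
        obtain rfl : _ = x := he
        obtain rfl : _ = y := he'
        exact sameCycle_map hι (d := (e, b)) (d' := (e', b'))
          ((R.sameCycle_iff _ _).2 (by simpa [scaffoldVert] using hv))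
  · let τ := σ * (Equiv.refl _).prodCongr Equiv.boolNot
    -- Every face is a face of `G` or consists of the two darts of one detached edge.
    let f : Quotient (Equiv.Perm.SameCycle.setoid R.facePerm) ⊕ Fin n × H3Edge →
        Quotient (Equiv.Perm.SameCycle.setoid τ) :=
      Sum.elim (Quotient.map' ι (fun d d' hd =>
        sameCycle_map (φ := R.facePerm) (τ := τ) (f := ι) (fun _ => rfl) hd))
        (fun e => Quotient.mk _ (.inr e, false))
    have hf : Function.Surjective f := by
      rintro ⟨e | e, b⟩
      · exact ⟨.inl (Quotient.mk _ (e, b)), rfl⟩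
      · refine ⟨.inr e, Quotient.sound ?_⟩
        cases b
        · exact Equiv.Perm.SameCycle.refl _ _
        · exact ⟨1, rfl⟩
    have := Nat.card_le_card_of_surjective f hf
    rw [Nat.card_sum, Nat.card_prod, H3Edge.card, Nat.card_fin] at this
    exact this

end Rotation

end Scaffold


/-! ### Transfer to the scaffolded graph: rotation systems, isolated vertices, connectedness -/

namespace Scaffold

variable {α β : Type*} {G : Graph α β} {n : ℕ}

instance : Finite H3Vertex :=
  Finite.of_surjective (Sum.elim H3Vertex.free (Sum.elim H3Vertex.mid H3Vertex.hub)) fun x => by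
    cases x with
    | free i => exact ⟨.inl i, rfl⟩
    | mid i => exact ⟨.inr (.inl i), rfl⟩
    | hub j => exact ⟨.inr (.inr j), rfl⟩

/-- The edges of the scaffolded graph. -/
def scaffoldEdgeEquiv (T : Triples G n) :
    G.edgeSet ⊕ Fin n × H3Edge ≃ (scaffoldedGraph G T).edgeSet where
  toFun
    | .inl e => ⟨.inl e.1, by
        obtain ⟨x, y, h⟩ := (G.edge_mem_iff_exists_isLink e.1).1 e.2
        exact ⟨_, _, x, y, h, rfl, rfl⟩⟩
    | .inr (i, e) => ⟨.inr (i, e), ⟨_, _, _, _, e.ends_eq, rfl, rfl⟩⟩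
  invFun e := match e with
    | ⟨.inl e, h⟩ => .inl ⟨e, by
        obtain ⟨_, _, _, _, h, -, -⟩ := h
        exact h.edge_mem⟩
    | ⟨.inr e, _⟩ => .inr e
  left_inv e := by rcases e with e | e <;> rfl
  right_inv e := by rcases e with ⟨e | e, h⟩ <;> rfl

theorem scaffoldedGraph_isLink (R : RotationSystem G) (T : Triples G n)
    (e : G.edgeSet ⊕ Fin n × H3Edge) :
    (scaffoldedGraph G T).IsLink (scaffoldEdgeEquiv T e).1 (scaffoldVert R T (e, false))
      (scaffoldVert R T (e, true)) := by
  rcases e with e | ⟨i, e⟩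
  · exact ⟨_, _, R.isLink e, rfl, rfl⟩
  · exact ⟨_, _, e.ends_eq, rfl, rfl⟩

/-- A rotation of all darts is a rotation system of the scaffolded graph. -/
theorem exists_rotationSystem [Finite G.edgeSet] {R : RotationSystem G} {T : Triples G n} {N : ℕ}
    (h : EdgesHaveRotation (scaffoldVert R T) Set.univ N) :
    ∃ R' : RotationSystem (scaffoldedGraph G T), numCycles R'.facePerm ≤ N := by
  obtain ⟨σ, hσ, hN⟩ := h
  let ε := (scaffoldEdgeEquiv T).prodCongr (Equiv.refl Bool)
  refine ⟨⟨fun d => scaffoldVert R T (ε.symm d), fun e => ?_, (ε.symm.trans σ).trans ε,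
    fun d d' => ?_⟩, le_trans ?_ hN⟩
  · have := scaffoldedGraph_isLink R T ((scaffoldEdgeEquiv T).symm e)
    rwa [Equiv.apply_symm_apply] at this
  · have h1 : σ.SameCycle (ε.symm d) (ε.symm d') ↔ _ := hσ _ _
    constructor
    · intro hd
      rcases h1.1 (sameCycle_map (f := ε.symm) (by simp) hd) with h2 | h2
      · rw [h2]
      · exact h2.2.2
    · intro hd
      simpa using sameCycle_map (f := ε) (τ := (ε.symm.trans σ).trans ε) (by simp)
        (h1.2 (Or.inr ⟨trivial, trivial, hd⟩))
  · refine Nat.card_le_card_of_surjective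
      (Quotient.map' ε fun d d' hd => sameCycle_map (fun d => ?_) hd) ?_
    · change ε (σ (ε.symm (ε ((Equiv.refl _).prodCongr Equiv.boolNot d)))) = _
      rw [Equiv.symm_apply_apply]
      rfl
    · rintro ⟨d⟩
      exact ⟨Quotient.mk _ (ε.symm d), congrArg (Quotient.mk _) (ε.apply_symm_apply d)⟩

theorem exists_vert_eq_of_inc (R : RotationSystem G) {e : β} {x : α} (h : G.Inc e x) :
    ∃ d, R.vert d = x := by
  obtain ⟨y, hy⟩ := h
  rcases hy.left_eq_or_eq (R.isLink ⟨e, hy.edge_mem⟩) with h | h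
  · exact ⟨_, h.symm⟩
  · exact ⟨_, h.symm⟩

theorem exists_inc_of_valence_ne_zero {x : α} (h : valence G x ≠ 0) : ∃ e, G.Inc e x := by
  by_contra! hx
  refine h ?_
  have h1 : {e | G.IsNonloopAt e x} = ∅ := by
    ext e
    simpa using fun h0 : G.IsNonloopAt e x => hx e h0.inc
  have h2 : {e | G.IsLoopAt e x} = ∅ := by
    ext e
    simpa using fun h0 : G.IsLoopAt e x => hx e h0.inc
  simp [valence, h1, h2]

theorem isolated_scaffoldedGraph_subset (T : Triples G n) :
    {x | x ∈ (scaffoldedGraph G T).vertexSet ∧ ∀ e, ¬ (scaffoldedGraph G T).Inc e x} ⊆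
      Sum.inl '' {x | x ∈ G.vertexSet ∧ ∀ e, ¬ G.Inc e x} := by
  rintro _ ⟨⟨x, hx, rfl⟩ | ⟨⟨i, ⟨w, hw⟩⟩, rfl⟩, he⟩
  · refine ⟨x, ⟨hx, fun e h => ?_⟩, rfl⟩
    obtain ⟨y, hy⟩ := h
    exact he (.inl e) ⟨.inl y, x, y, hy, rfl, rfl⟩
  · exfalso
    rcases w with j | j | j
    · exact hw j rfl
    · exact he (.inr (i, .free j)) ⟨_, .mid j, .free j, Sym2.eq_swap, rfl, rfl⟩
    · exact he (.inr (i, .spoke 0 j)) ⟨_, .hub j, .mid 0, Sym2.eq_swap, rfl, rfl⟩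

theorem IsConnected.scaffoldedGraph (hG : IsConnected G) (T : Triples G n) :
    IsConnected (scaffoldedGraph G T) := by
  obtain ⟨⟨x₀, hx₀⟩, hG⟩ := hG
  have hold : ∀ x ∈ G.vertexSet,
      Relation.ReflTransGen (Scaffold.scaffoldedGraph G T).Adj (.inl x) (.inl x₀) := by
    intro x hx
    induction hG x hx x₀ hx₀ using Relation.ReflTransGen.head_induction_on with
    | refl => exact .refl
    | head h _ ih =>
      obtain ⟨e, he⟩ := h
      exact (ih he.right_mem).head ⟨.inl e, _, _, he, rfl, rfl⟩
  have hmid : ∀ i j, Relation.ReflTransGen (Scaffold.scaffoldedGraph G T).Adj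
      (T.glue i (.mid j)) (.inl x₀) := fun i j =>
    (hold _ (T.mem i j)).head ⟨.inr (i, .free j), .mid j, .free j, Sym2.eq_swap, rfl, rfl⟩
  have key : ∀ x ∈ (Scaffold.scaffoldedGraph G T).vertexSet,
      Relation.ReflTransGen (Scaffold.scaffoldedGraph G T).Adj x (.inl x₀) := by
    rintro _ (⟨x, hx, rfl⟩ | ⟨⟨i, ⟨w, hw⟩⟩, rfl⟩)
    · exact hold x hx
    · rcases w with j | j | j
      · exact absurd rfl (hw j)
      · exact hmid i j
      · exact (hmid i 0).head ⟨.inr (i, .spoke 0 j), .hub j, .mid 0, Sym2.eq_swap, rfl, rfl⟩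
  refine ⟨⟨.inl x₀, Or.inl ⟨x₀, hx₀, rfl⟩⟩, fun x hx y hy => (key x hx).trans ?_⟩
  have : Std.Symm (Scaffold.scaffoldedGraph G T).Adj := ⟨fun _ _ h => h.symm⟩
  exact Relation.ReflTransGen.stdSymm.symm _ _ (key y hy)

/-- Attaching only bounds the faces from above; this excludes zero. The isolated-vertex term is
needed when there are no edges. -/
theorem RotationSystem.numFaces_pos (R : RotationSystem G) (hV : G.vertexSet.Finite)
    (hE : G.edgeSet.Finite) (hne : G.vertexSet.Nonempty) : 0 < R.numFaces := by
  have := hE.to_subtype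
  by_cases he : ∃ e, e ∈ G.edgeSet
  · obtain ⟨e, he⟩ := he
    have : Nonempty (Quotient (Equiv.Perm.SameCycle.setoid R.facePerm)) :=
      ⟨Quotient.mk _ (⟨e, he⟩, false)⟩
    exact Nat.add_pos_left Nat.card_pos _
  · obtain ⟨x, hx⟩ := hne
    refine Nat.add_pos_right _ ((Set.ncard_pos (hV.subset fun _ h => h.1)).2 ⟨x, hx, ?_⟩)
    exact fun e h => he ⟨e, h.edge_mem⟩

end Scaffold

theorem mainTheorem8 {α β : Type*} (G : Graph α β)
    (hV : G.vertexSet.Finite) (hE : G.edgeSet.Finite)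
    (hG : Scaffold.UpperEmbeddable G) (n : ℕ) (T : Scaffold.Triples G n) :
    Scaffold.UpperEmbeddable (Scaffold.scaffoldedGraph G T) := by
  obtain ⟨hconn, R, hR⟩ := hG
  have := hE.to_subtype
  have hT : ∀ i j, ∃ d, R.vert d = T.vert i j := fun i j =>
    (Scaffold.exists_inc_of_valence_ne_zero (by rw [T.valence_eq i j]; decide)).elim
      fun _ he => Scaffold.exists_vert_eq_of_inc R he
  have hrot := Scaffold.EdgesHaveRotation.all_copies hT Finset.univ
    (Scaffold.numCycles R.facePerm)
    (by simpa [mul_comm] using Scaffold.edgesHaveRotation_base (R := R) (T := T))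
  have huniv : Set.range Sum.inl ∪ {x : G.edgeSet ⊕ Fin n × Scaffold.H3Edge |
      ∃ i ∈ Finset.univ, ∃ e, x = Sum.inr (i, e)} = Set.univ := by
    ext x
    rcases x with x | ⟨i, e⟩ <;> simp
  rw [huniv] at hrot
  obtain ⟨R', hR'⟩ := Scaffold.exists_rotationSystem hrot
  have hconn' := hconn.scaffoldedGraph T
  refine ⟨hconn', R', ?_⟩
  -- The extra faces assigned to isolated vertices do not increase either.
  have hiso : {x | x ∈ (Scaffold.scaffoldedGraph G T).vertexSet ∧
      ∀ e, ¬ (Scaffold.scaffoldedGraph G T).Inc e x}.ncard ≤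
      {x | x ∈ G.vertexSet ∧ ∀ e, ¬ G.Inc e x}.ncard := by
    have hfin : {x | x ∈ G.vertexSet ∧ ∀ e, ¬ G.Inc e x}.Finite := hV.subset fun _ h => h.1
    exact (Set.ncard_le_ncard (Scaffold.isolated_scaffoldedGraph_subset T) (hfin.image _)).trans
      (Set.ncard_image_le hfin)
  have hle : R'.numFaces ≤ R.numFaces := Nat.add_le_add hR' hiso
  have hpos := R'.numFaces_pos ((hV.image _).union (Set.finite_range _))
    (Set.finite_coe_iff.1 (Finite.of_equiv _ (Scaffold.scaffoldEdgeEquiv T))) hconn'.1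
  omega
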